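/- Let $N\ge 2$ be an integer and let $v>0$. Let $H$ be an $N\times N$ random matrix from one of the following two ensembles, with scale $v$. - GOE: $H$ is real symmetric, its entries $H_{ij}$, $i\le j$, are independent centred Gaussian random variables, and $\operatorname{Var}H_{ii}=2v$, $\operatorname{Var}H_{ij}=v$ for $i<j$; equivalently, $H$ has density proportional to $\exp\left(-\frac{1}{4v}\operatorname{tr}H^2\right)$ on the real symmetric matrices. - GUE: $H$ is complex Hermitian, the random variables $H_{ii}$ ($1\le i\le N$) and $\operatorname{Re}H_{ij}$, $\operatorname{Im}H_{ij}$ ($i<j$) are independent centred Gaussian, and $\operatorname{Var}H_{ii}=v$, $\operatorname{Var}\operatorname{Re}H_{ij}=\operatorname{Var}\operatorname{Im}H_{ij}=v/2$ for $i<j$; equivalently, $H$ has density proportional to $\exp\left(-\frac{1}{2v}\operatorname{tr}H^2\right)$ on the complex Hermitian matrices. Then the largest eigenvalue $\lambda_{\max}$ of $H$ is a (measurable) real random variable that is not infinitely divisible: it is not the case that for every $n\ge1$ there exist independent identically distributed real random variables $X_1,\dots,X_n$ such that $\lambda_{\max}$ has the same distribution as $X_1+\cdots+X_n$. -/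

import Mathlib

open MeasureTheory ProbabilityTheory
open scoped NNReal

/-- A real random variable `X` is infinitely divisible if for every `n ≥ 1` there are `n`
independent identically distributed real random variables (on some probability space) whose sum
has the same distribution as `X`. -/
def IsInfinitelyDivisible {Ω : Type*} [MeasurableSpace Ω] (X : Ω → ℝ) (P : Measure Ω) : Prop :=
  ∀ n : ℕ, 1 ≤ n →
    ∃ (Ω' : Type) (_ : MeasurableSpace Ω') (P' : Measure Ω') (_ : IsProbabilityMeasure P')
      (Y : Fin n → Ω' → ℝ),
      iIndepFun Y P' ∧
      (∀ i j, IdentDistrib (Y i) (Y j) P' P') ∧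
      IdentDistrib X (fun ω' => ∑ i, Y i ω') P P'

/-- The largest (real) eigenvalue of a square real or complex matrix; meaningful for Hermitian
matrices of positive size, whose spectrum is a nonempty finite set of real numbers. -/
noncomputable def largestEigenvalue {n 𝕜 : Type*} [Fintype n] [DecidableEq n] [RCLike 𝕜]
    (A : Matrix n n 𝕜) : ℝ :=
  sSup (spectrum ℝ A)

theorem largestEigenvalue_isGreatest {n 𝕜 : Type*} [Fintype n] [DecidableEq n] [Nonempty n]
    [RCLike 𝕜] {A : Matrix n n 𝕜} (hA : A.IsHermitian) :
    IsGreatest (spectrum ℝ A) (largestEigenvalue A) := by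
  have h : spectrum ℝ A = Set.range hA.eigenvalues := hA.spectrum_real_eq_range_eigenvalues
  unfold largestEigenvalue
  rw [h]
  have hne : (Set.range hA.eigenvalues).Nonempty := Set.range_nonempty _
  have hfin : (Set.range hA.eigenvalues).Finite := Set.finite_range _
  exact ⟨hne.csSup_mem hfin, fun x hx => le_csSup hfin.bddAbove hx⟩

/-- `H` is an `N × N` GOE random matrix with scale `v`: a real symmetric random matrix whose
entries on and above the diagonal are independent centred Gaussian variables with joint density
proportional to `exp (-(1 / (4 * v)) * tr (H ^ 2))`, that is, with variance `2 * v` on the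
diagonal and `v` off the diagonal. -/
structure IsGOE {Ω : Type*} [MeasurableSpace Ω] {N : ℕ} (H : Ω → Matrix (Fin N) (Fin N) ℝ)
    (v : ℝ≥0) (P : Measure Ω) : Prop where
  isSymm : ∀ ω, (H ω).IsSymm
  law_diag : ∀ i, HasLaw (fun ω => H ω i i) (gaussianReal 0 (2 * v)) P
  law_offDiag : ∀ i j, i < j → HasLaw (fun ω => H ω i j) (gaussianReal 0 v) P
  indep : iIndepFun (fun (p : {p : Fin N × Fin N // p.1 ≤ p.2}) ω => H ω p.1.1 p.1.2) P

/-- `H` is an `N × N` GUE random matrix with scale `v`: a complex Hermitian random matrix such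
that the diagonal entries and the real and imaginary parts of the entries above the diagonal are
independent centred Gaussian variables with joint density proportional to
`exp (-(2 / (4 * v)) * tr (H ^ 2))`, that is, with variance `v` on the diagonal and `v / 2` for
each of the real and imaginary parts off the diagonal. -/
structure IsGUE {Ω : Type*} [MeasurableSpace Ω] {N : ℕ} (H : Ω → Matrix (Fin N) (Fin N) ℂ)
    (v : ℝ≥0) (P : Measure Ω) : Prop where
  isHermitian : ∀ ω, (H ω).IsHermitian
  law_diag : ∀ i, HasLaw (fun ω => (H ω i i).re) (gaussianReal 0 v) P
  law_offDiag_re : ∀ i j, i < j → HasLaw (fun ω => (H ω i j).re) (gaussianReal 0 (v / 2)) P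
  law_offDiag_im : ∀ i j, i < j → HasLaw (fun ω => (H ω i j).im) (gaussianReal 0 (v / 2)) P
  /-- The pairs `i ≤ j` index the real parts of the entries on and above the diagonal, the pairs
  `j < i` index the imaginary parts of the entries `(j, i)` above the diagonal. -/
  indep : iIndepFun (fun (p : Fin N × Fin N) ω =>
    if p.1 ≤ p.2 then (H ω p.1 p.2).re else (H ω p.2 p.1).im) P

/-!
If an infinitely divisible random variable is sub-Gaussian, its moment generating function is
entire. It has no zeros: the transform of an `n`-th convolution root is an analytic `n`-th root of
it for every `n`, so the order of a zero would be divisible by every `n`. Being of growth order at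
most `2`, it is then the exponential of a quadratic polynomial, and the variable is Gaussian.

The largest eigenvalue is sub-Gaussian and dominates every diagonal entry, hence also the average
of two independent ones. A Gaussian variable dominating another one has the same variance, since
otherwise one of the two Gaussian tails would be too heavy. But a diagonal entry and the average
of two independent ones have different variances, so the largest eigenvalue is not Gaussian.
-/

section EntireFunctions

variable {f : ℂ → ℂ} {C : ℝ} {n : ℕ}

theorem exists_eq_cexp_of_forall_ne_zero (hf : Differentiable ℂ f) (hne : ∀ z, f z ≠ 0) :
    ∃ g : ℂ → ℂ, Differentiable ℂ g ∧ ∀ z, f z = Complex.exp (g z) := by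
  obtain ⟨g, hg0, hg⟩ := (hf.deriv.div hf hne).isExactOn_univ.with_val_at 0 (Complex.log (f 0))
  refine ⟨g, fun z => (hg z trivial).differentiableAt, fun z => ?_⟩
  have hderiv (z : ℂ) : HasDerivAt (fun z => f z * Complex.exp (-g z)) 0 z := by
    refine ((hf z).hasDerivAt.mul (hg z trivial).neg.cexp).congr_deriv ?_
    have hfz := hne z
    simp only [Pi.div_apply]
    field_simp
    ring
  have hconst : f z * Complex.exp (-g z) = f 0 * Complex.exp (-g 0) :=
    is_const_of_deriv_eq_zero (fun z => (hderiv z).differentiableAt) (fun z => (hderiv z).deriv) z 0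
  rw [hg0, Complex.exp_neg, Complex.exp_neg, Complex.exp_log (hne 0), mul_inv_cancel₀ (hne 0)]
    at hconst
  exact (mul_inv_eq_one₀ (Complex.exp_ne_zero _)).1 hconst

theorem exists_norm_le_of_re_le_pow (hf : Differentiable ℂ f) (hC : 0 < C)
    (hre : ∀ z, (f z).re ≤ C * (1 + ‖z‖) ^ n) :
    ∃ C', ∀ z, ‖f z‖ ≤ C' * (1 + ‖z‖) ^ n := by
  refine ⟨2 * (C * 2 ^ n) + 3 * ‖f 0‖, fun z => ?_⟩
  set r := ‖z‖ with hr
  have hr0 : 0 ≤ r := norm_nonneg z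
  have hmaps : Set.MapsTo f (Metric.ball 0 (1 + 2 * r)) {w | w.re ≤ C * 2 ^ n * (1 + r) ^ n} := by
    intro w hw
    rw [mem_ball_zero_iff] at hw
    calc (f w).re ≤ C * (1 + ‖w‖) ^ n := hre w
      _ ≤ C * (2 * (1 + r)) ^ n := by gcongr; linarith
      _ = C * 2 ^ n * (1 + r) ^ n := by rw [mul_pow, mul_assoc]
  have hbc := Complex.borelCaratheodory (by positivity) hf.differentiableOn hmaps
    (by positivity) (mem_ball_zero_iff.2 (by linarith) : z ∈ _)
  rw [← hr, show 1 + 2 * r - r = 1 + r by ring] at hbc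
  have hpow : 1 ≤ (1 + r) ^ n := one_le_pow₀ (by linarith)
  have hratio₁ : r / (1 + r) ≤ 1 := div_le_one_of_le₀ (by linarith) (by positivity)
  have hratio₂ : (1 + 2 * r + r) / (1 + r) ≤ 3 := (div_le_iff₀ (by positivity)).2 (by linarith)
  calc ‖f z‖ ≤ 2 * (C * 2 ^ n * (1 + r) ^ n) * (r / (1 + r))
        + ‖f 0‖ * ((1 + 2 * r + r) / (1 + r)) := by simpa only [mul_div_assoc] using hbc
    _ ≤ 2 * (C * 2 ^ n * (1 + r) ^ n) * 1 + ‖f 0‖ * 3 := by gcongr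
    _ ≤ (2 * (C * 2 ^ n) + 3 * ‖f 0‖) * (1 + r) ^ n := by
        nlinarith [mul_le_mul_of_nonneg_left hpow (norm_nonneg (f 0))]

theorem iteratedDeriv_zero_eq_zero_of_norm_le_pow (hf : Differentiable ℂ f)
    (hbound : ∀ z, ‖f z‖ ≤ C * (1 + ‖z‖) ^ n) {k : ℕ} (hk : n < k) :
    iteratedDeriv k f 0 = 0 := by
  have hC : 0 ≤ C := by simpa using (norm_nonneg _).trans (hbound 0)
  have hcauchy (R : ℝ) (hR : 1 ≤ R) : ‖iteratedDeriv k f 0‖ ≤ k.factorial * (C * 2 ^ n) / R := by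
    have hR0 : 0 < R := by linarith
    calc ‖iteratedDeriv k f 0‖ ≤ k.factorial * (C * (1 + R) ^ n) / R ^ k :=
          Complex.norm_iteratedDeriv_le_of_forall_mem_sphere_norm_le k hR0 hf.diffContOnCl
            fun z hz => by simpa only [mem_sphere_zero_iff_norm.1 hz] using hbound z
      _ ≤ k.factorial * (C * (2 * R) ^ n) / R ^ (n + 1) := by
          gcongr
          · linarith
          · exact hk
      _ = k.factorial * (C * 2 ^ n) / R := by
          rw [mul_pow, pow_succ]
          field_simp
  rw [← norm_le_zero_iff]
  exact ge_of_tendsto (Filter.tendsto_id.const_div_atTop _)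
    ((Filter.eventually_ge_atTop 1).mono hcauchy)

theorem exists_polynomial_of_norm_le_pow (hf : Differentiable ℂ f)
    (hbound : ∀ z, ‖f z‖ ≤ C * (1 + ‖z‖) ^ n) :
    ∃ p : Polynomial ℂ, p.natDegree ≤ n ∧ ∀ z, f z = p.eval z := by
  refine ⟨∑ k ∈ Finset.range (n + 1),
    Polynomial.C ((k.factorial : ℂ)⁻¹ * iteratedDeriv k f 0) * Polynomial.X ^ k, ?_, fun z => ?_⟩
  · exact Polynomial.natDegree_sum_le_of_forall_le _ _ fun k hk =>
      (Polynomial.natDegree_C_mul_X_pow_le _ _).trans (by grind)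
  · rw [← Complex.taylorSeries_eq_of_entire' 0 z hf, tsum_eq_sum (s := Finset.range (n + 1))]
    · simp [Polynomial.eval_finsetSum]
    · intro k hk
      rw [iteratedDeriv_zero_eq_zero_of_norm_le_pow hf hbound (by simpa using hk)]
      simp

theorem exists_eq_cexp_polynomial_of_norm_le_exp_pow (hf : Differentiable ℂ f)
    (hne : ∀ z, f z ≠ 0) (hC : 0 < C) (hbound : ∀ z, ‖f z‖ ≤ Real.exp (C * (1 + ‖z‖) ^ n)) :
    ∃ p : Polynomial ℂ, p.natDegree ≤ n ∧ ∀ z, f z = Complex.exp (p.eval z) := by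
  obtain ⟨g, hg, hfg⟩ := exists_eq_cexp_of_forall_ne_zero hf hne
  have hre (z : ℂ) : (g z).re ≤ C * (1 + ‖z‖) ^ n := by
    simpa only [hfg, Complex.norm_exp, Real.exp_le_exp] using hbound z
  obtain ⟨C', hC'⟩ := exists_norm_le_of_re_le_pow hg hC hre
  obtain ⟨p, hp, hgp⟩ := exists_polynomial_of_norm_le_pow hg hC'
  exact ⟨p, hp, fun z => by rw [hfg, hgp]⟩

end EntireFunctions

theorem analyticOrderAt_eq_top_of_forall_exists_pow {𝕜 : Type*} [NontriviallyNormedField 𝕜]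
    {f : 𝕜 → 𝕜} {z : 𝕜} (hz : f z = 0)
    (hroot : ∀ n : ℕ, 1 ≤ n → ∃ g : 𝕜 → 𝕜, AnalyticAt 𝕜 g z ∧ f = g ^ n) :
    analyticOrderAt f z = ⊤ := by
  refine ENat.eq_top_iff_forall_ge.2 fun n => ?_
  obtain ⟨g, hg, rfl⟩ := hroot (n + 1) n.succ_pos
  have hgz : g z = 0 := eq_zero_of_pow_eq_zero hz
  have hord : 1 ≤ analyticOrderAt g z :=
    Order.one_le_iff_ne_zero.2 fun h => hg.analyticOrderAt_eq_zero.1 h hgz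
  calc (n : ℕ∞) ≤ (n + 1 : ℕ) := by simp
    _ ≤ (n + 1 : ℕ) * analyticOrderAt g z := le_mul_of_one_le_right' hord
    _ = analyticOrderAt (g ^ (n + 1)) z := by rw [analyticOrderAt_pow hg, nsmul_eq_mul]

theorem norm_le_abs_re_add_abs_im {𝕜 : Type*} [RCLike 𝕜] (z : 𝕜) :
    ‖z‖ ≤ |RCLike.re z| + |RCLike.im z| := by
  refine (abs_le_of_sq_le_sq' ?_ (by positivity)).2
  rw [RCLike.norm_sq_eq_def, add_sq, sq_abs, sq_abs]
  linarith [mul_nonneg (abs_nonneg (RCLike.re z)) (abs_nonneg (RCLike.im z))]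

/-- A random vector is sub-Gaussian if `exp (C * ‖X‖ ^ 2)` is integrable for some `C > 0`. Unlike
Mathlib's `HasSubgaussianMGF` this condition does not force `X` to be centred, and it is inherited
by every random vector of smaller norm. -/
structure IsSubgaussian {Ω E : Type*} [MeasurableSpace Ω] [NormedAddCommGroup E] (X : Ω → E)
    (P : Measure Ω) : Prop where
  aestronglyMeasurable : AEStronglyMeasurable X P
  exists_integrable : ∃ C > 0, Integrable (fun ω => Real.exp (C * ‖X ω‖ ^ 2)) P

section IsSubgaussian

variable {Ω E F : Type*} [MeasurableSpace Ω] {P : Measure Ω} [NormedAddCommGroup E]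
  [NormedAddCommGroup F]

namespace IsSubgaussian

theorem mono {X : Ω → E} {Y : Ω → F} (hX : IsSubgaussian X P) (hY : AEStronglyMeasurable Y P)
    (hle : ∀ᵐ ω ∂P, ‖Y ω‖ ≤ ‖X ω‖) : IsSubgaussian Y P := by
  obtain ⟨C, hC, hint⟩ := hX.exists_integrable
  refine ⟨hY, C, hC, hint.mono' ?_ ?_⟩
  · exact Real.continuous_exp.comp_aestronglyMeasurable ((hY.norm.pow 2).const_mul C)
  · filter_upwards [hle] with ω hω
    rw [Real.norm_of_nonneg (Real.exp_nonneg _)]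
    gcongr

theorem norm {X : Ω → E} (hX : IsSubgaussian X P) : IsSubgaussian (fun ω => ‖X ω‖) P :=
  hX.mono hX.aestronglyMeasurable.norm (ae_of_all _ fun ω => (norm_norm (X ω)).le)

theorem add {X Y : Ω → E} (hX : IsSubgaussian X P) (hY : IsSubgaussian Y P) :
    IsSubgaussian (X + Y) P := by
  obtain ⟨C, hC, hXint⟩ := hX.exists_integrable
  obtain ⟨D, hD, hYint⟩ := hY.exists_integrable
  have hmeas := hX.aestronglyMeasurable.add hY.aestronglyMeasurable
  refine ⟨hmeas, min C D / 4, by positivity, (hXint.add hYint).mono' ?_ (ae_of_all _ fun ω => ?_)⟩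
  · exact Real.continuous_exp.comp_aestronglyMeasurable ((hmeas.norm.pow 2).const_mul _)
  rw [Real.norm_of_nonneg (Real.exp_nonneg _)]
  set m := max ‖X ω‖ ‖Y ω‖ with hm
  have hnorm : ‖(X + Y) ω‖ ≤ 2 * m := by
    rw [two_mul]
    exact (norm_add_le _ _).trans (add_le_add (le_max_left _ _) (le_max_right _ _))
  have hexp : min C D / 4 * ‖(X + Y) ω‖ ^ 2 ≤ min C D * m ^ 2 :=
    calc min C D / 4 * ‖(X + Y) ω‖ ^ 2 ≤ min C D / 4 * (2 * m) ^ 2 := by gcongr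
      _ = min C D * m ^ 2 := by ring
  refine (Real.exp_le_exp.2 hexp).trans ?_
  rcases max_choice ‖X ω‖ ‖Y ω‖ with h | h
  · rw [hm, h]
    refine (Real.exp_le_exp.2 ?_).trans (le_add_of_nonneg_right (Real.exp_nonneg _))
    gcongr
    exact min_le_left _ _
  · rw [hm, h]
    refine (Real.exp_le_exp.2 ?_).trans (le_add_of_nonneg_left (Real.exp_nonneg _))
    gcongr
    exact min_le_right _ _

theorem sum [IsFiniteMeasure P] {ι : Type*} {X : ι → Ω → E} (s : Finset ι)
    (hX : ∀ i ∈ s, IsSubgaussian (X i) P) : IsSubgaussian (∑ i ∈ s, X i) P :=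
  Finset.sum_induction X (IsSubgaussian · P) (fun _ _ => add)
    ⟨aestronglyMeasurable_zero, 1, one_pos, by simp⟩ hX

theorem of_re_im {𝕜 : Type*} [RCLike 𝕜] {X : Ω → 𝕜}
    (hre : IsSubgaussian (fun ω => RCLike.re (X ω)) P)
    (him : IsSubgaussian (fun ω => RCLike.im (X ω)) P) : IsSubgaussian X P := by
  have hmeas : AEStronglyMeasurable X P :=
    (aemeasurable_of_re_im hre.aestronglyMeasurable.aemeasurable
      him.aestronglyMeasurable.aemeasurable).aestronglyMeasurable
  refine (hre.norm.add him.norm).mono hmeas (ae_of_all _ fun ω => ?_)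
  exact (norm_le_abs_re_add_abs_im (X ω)).trans (Real.le_norm_self _)

end IsSubgaussian

theorem isSubgaussian_of_hasLaw_isGaussian [NormedSpace ℝ E] [MeasurableSpace E] [BorelSpace E]
    [SecondCountableTopology E] [CompleteSpace E] {X : Ω → E} {μ : Measure E} [IsGaussian μ]
    (hX : HasLaw X μ P) : IsSubgaussian X P := by
  refine ⟨hX.aemeasurable.aestronglyMeasurable, ?_⟩
  obtain ⟨C, hC, hint⟩ := IsGaussian.exists_integrable_exp_sq μ
  rw [← hX.map_eq] at hint
  exact ⟨C, hC, hint.comp_aemeasurable hX.aemeasurable⟩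

variable {X : Ω → ℝ}

theorem exp_mul_le_exp_mul_exp_sq {C : ℝ} (hC : 0 < C) (t x : ℝ) :
    Real.exp (t * x) ≤ Real.exp (t ^ 2 / (4 * C)) * Real.exp (C * x ^ 2) := by
  rw [← Real.exp_add, Real.exp_le_exp, ← sub_nonneg]
  have hsq : t ^ 2 / (4 * C) + C * x ^ 2 - t * x = (2 * C * x - t) ^ 2 / (4 * C) := by
    field_simp
    ring
  rw [hsq]
  positivity

theorem IsSubgaussian.integrable_exp_mul (hX : IsSubgaussian X P) (t : ℝ) :
    Integrable (fun ω => Real.exp (t * X ω)) P := by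
  obtain ⟨C, hC, hint⟩ := hX.exists_integrable
  refine (hint.const_mul (Real.exp (t ^ 2 / (4 * C)))).mono' ?_ (ae_of_all _ fun ω => ?_)
  · exact Real.continuous_exp.comp_aestronglyMeasurable (hX.aestronglyMeasurable.const_mul t)
  · rw [Real.norm_of_nonneg (Real.exp_nonneg _)]
    simpa only [Real.norm_eq_abs, sq_abs] using exp_mul_le_exp_mul_exp_sq hC t (X ω)

theorem IsSubgaussian.exists_mgf_le (hX : IsSubgaussian X P) :
    ∃ K > 0, ∀ t, mgf X P t ≤ Real.exp (K * (1 + |t|) ^ 2) := by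
  obtain ⟨C, hC, hint⟩ := hX.exists_integrable
  set I := ∫ ω, Real.exp (C * ‖X ω‖ ^ 2) ∂P
  have hI : 0 ≤ I := integral_nonneg fun ω => Real.exp_nonneg _
  refine ⟨1 / (4 * C) + I, add_pos_of_pos_of_nonneg (by positivity) hI, fun t => ?_⟩
  calc mgf X P t ≤ ∫ ω, Real.exp (t ^ 2 / (4 * C)) * Real.exp (C * ‖X ω‖ ^ 2) ∂P :=
        integral_mono (hX.integrable_exp_mul t) (hint.const_mul _) fun ω => by
          simpa only [Real.norm_eq_abs, sq_abs] using exp_mul_le_exp_mul_exp_sq hC t (X ω)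
    _ = Real.exp (t ^ 2 / (4 * C)) * I := integral_const_mul _ _
    _ ≤ Real.exp (t ^ 2 / (4 * C)) * Real.exp I := by
        gcongr
        linarith [Real.add_one_le_exp I]
    _ = Real.exp (1 / (4 * C) * |t| ^ 2 + I * 1) := by
        rw [← Real.exp_add, sq_abs]
        ring_nf
    _ ≤ Real.exp (1 / (4 * C) * (1 + |t|) ^ 2 + I * (1 + |t|) ^ 2) := by
        gcongr
        · linarith
        · exact one_le_pow₀ (by linarith [abs_nonneg t])
    _ = Real.exp ((1 / (4 * C) + I) * (1 + |t|) ^ 2) := by rw [add_mul]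

end IsSubgaussian

section InfinitelyDivisible

variable {Ω : Type*} [MeasurableSpace Ω] {P : Measure Ω} {X : Ω → ℝ}

theorem differentiable_complexMGF (hint : ∀ t : ℝ, Integrable (fun ω => Real.exp (t * X ω)) P) :
    Differentiable ℂ (complexMGF X P) := fun z =>
  (analyticAt_complexMGF (by
    rw [show integrableExpSet X P = Set.univ from Set.eq_univ_of_forall hint, interior_univ]
    trivial)).differentiableAt

theorem complexMGF_sum_of_identDistrib {ι : Type*} [Fintype ι] {Y : ι → Ω → ℝ}
    (hindep : iIndepFun Y P) (i₀ : ι) (hident : ∀ i, IdentDistrib (Y i) (Y i₀) P P) (z : ℂ) :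
    complexMGF (fun ω => ∑ i, Y i ω) P z = complexMGF (Y i₀) P z ^ Fintype.card ι := by
  have hexp : Continuous fun x : ℝ => Complex.exp (z * x) := by fun_prop
  calc complexMGF (fun ω => ∑ i, Y i ω) P z = ∫ ω, ∏ i, Complex.exp (z * Y i ω) ∂P := by
        simp only [complexMGF, Complex.ofReal_sum, Finset.mul_sum, Complex.exp_sum]
    _ = ∏ i, complexMGF (Y i) P z :=
        hindep.integral_fun_prod_comp (f := fun _ (x : ℝ) => Complex.exp (z * x))
          (fun i => (hident i).aemeasurable_fst) fun _ => hexp.aestronglyMeasurable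
    _ = complexMGF (Y i₀) P z ^ Fintype.card ι := by
        simp only [complexMGF_congr_identDistrib (hident _), Finset.prod_const, Finset.card_univ]

theorem hasLaw_gaussianReal_of_mgf_eq [IsFiniteMeasure P] {m : ℝ} {s : ℝ≥0}
    (hX : AEMeasurable X P) (hmgf : ∀ t, mgf X P t = Real.exp (m * t + s * t ^ 2 / 2)) :
    HasLaw X (gaussianReal m s) P := by
  have heq : mgf id (gaussianReal m s) = mgf X P := by rw [mgf_id_gaussianReal, ← funext hmgf]
  have hcomplex : complexMGF id (gaussianReal m s) = complexMGF X P :=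
    funext fun z => eqOn_complexMGF_of_mgf heq (by simp)
  exact ⟨hX, by simpa using (Measure.ext_of_complexMGF_eq aemeasurable_id hX hcomplex).symm⟩

namespace IsInfinitelyDivisible

theorem exists_complexMGF_eq_pow [IsProbabilityMeasure P] (hX : IsInfinitelyDivisible X P)
    (hint : ∀ t : ℝ, Integrable (fun ω => Real.exp (t * X ω)) P) {n : ℕ} (hn : 1 ≤ n) :
    ∃ g : ℂ → ℂ, Differentiable ℂ g ∧ complexMGF X P = g ^ n := by
  obtain ⟨Ω', _, P', _, Y, hindep, hident, hsum⟩ := hX n hn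
  let i₀ : Fin n := ⟨0, hn⟩
  have hpow : complexMGF X P = complexMGF (Y i₀) P' ^ n := funext fun z => by
    rw [complexMGF_congr_identDistrib hsum,
      complexMGF_sum_of_identDistrib hindep i₀ (fun i => hident i i₀), Fintype.card_fin,
      Pi.pow_apply]
  refine ⟨complexMGF (Y i₀) P', differentiable_complexMGF fun t => ?_, hpow⟩
  -- A divergent exponential moment would make the junk value of `complexMGF (Y i₀) P'` at `t`,
  -- hence `mgf X P t`, vanish.
  by_contra hdiv
  have hzero : complexMGF X P t = 0 := by
    rw [hpow, Pi.pow_apply, complexMGF_ofReal, mgf_undef hdiv, Complex.ofReal_zero,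
      zero_pow (by omega)]
  rw [complexMGF_ofReal, Complex.ofReal_eq_zero] at hzero
  exact (mgf_pos (hint t)).ne' hzero

theorem complexMGF_ne_zero [IsProbabilityMeasure P] (hX : IsInfinitelyDivisible X P)
    (hint : ∀ t : ℝ, Integrable (fun ω => Real.exp (t * X ω)) P) (z : ℂ) :
    complexMGF X P z ≠ 0 := fun hz => by
  have hanalytic : AnalyticOnNhd ℂ (complexMGF X P) Set.univ :=
    (differentiable_complexMGF hint).differentiableOn.analyticOnNhd isOpen_univ
  have horder₀ : analyticOrderAt (complexMGF X P) 0 ≠ ⊤ := by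
    rw [analyticOrderAt_eq_zero.2 (Or.inr (by simp [complexMGF]))]
    exact ENat.zero_ne_top
  refine hanalytic.analyticOrderAt_ne_top_of_isPreconnected isPreconnected_univ
    (Set.mem_univ 0) (Set.mem_univ z) horder₀ ?_
  refine analyticOrderAt_eq_top_of_forall_exists_pow hz fun n hn => ?_
  obtain ⟨g, hg, hpow⟩ := hX.exists_complexMGF_eq_pow hint hn
  exact ⟨g, hg.analyticAt z, hpow⟩

theorem exists_complexMGF_eq_cexp_quadratic [IsProbabilityMeasure P]
    (hX : IsInfinitelyDivisible X P) (hsub : IsSubgaussian X P) :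
    ∃ a b c : ℂ, ∀ z, complexMGF X P z = Complex.exp (a + b * z + c * z ^ 2) := by
  obtain ⟨K, hK, hmgf⟩ := hsub.exists_mgf_le
  have hbound (z : ℂ) : ‖complexMGF X P z‖ ≤ Real.exp (K * (1 + ‖z‖) ^ 2) :=
    calc ‖complexMGF X P z‖ ≤ mgf X P z.re := norm_complexMGF_le_mgf
      _ ≤ Real.exp (K * (1 + |z.re|) ^ 2) := hmgf z.re
      _ ≤ Real.exp (K * (1 + ‖z‖) ^ 2) := by
          gcongr
          exact Complex.abs_re_le_norm z
  obtain ⟨p, hp, hexp⟩ := exists_eq_cexp_polynomial_of_norm_le_exp_pow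
    (differentiable_complexMGF hsub.integrable_exp_mul)
    (hX.complexMGF_ne_zero hsub.integrable_exp_mul) hK hbound
  refine ⟨p.coeff 0, p.coeff 1, p.coeff 2, fun z => ?_⟩
  rw [hexp, Polynomial.eval_eq_sum_range' (Nat.lt_succ_of_le hp)]
  simp only [Finset.sum_range_succ, Finset.sum_range_zero, pow_zero, pow_one, mul_one, zero_add]

theorem exists_hasLaw_gaussianReal [IsProbabilityMeasure P] (hX : IsInfinitelyDivisible X P)
    (hsub : IsSubgaussian X P) : ∃ (m : ℝ) (s : ℝ≥0), HasLaw X (gaussianReal m s) P := by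
  obtain ⟨a, b, c, hexp⟩ := hX.exists_complexMGF_eq_cexp_quadratic hsub
  have hmgf (t : ℝ) : mgf X P t = Real.exp (a.re + b.re * t + c.re * t ^ 2) := by
    have hnorm := congrArg norm (hexp t)
    rw [complexMGF_ofReal, Complex.norm_real, Real.norm_of_nonneg mgf_nonneg,
      Complex.norm_exp] at hnorm
    simpa [← Complex.ofReal_pow] using hnorm
  have ha : a.re = 0 := by simpa using (hmgf 0).symm
  have hc : 0 ≤ c.re := by
    have hle (z : ℂ) (hz : z.re = 0) : (a + b * z + c * z ^ 2).re ≤ 0 := by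
      rw [← Real.exp_le_one_iff, ← Complex.norm_exp, ← hexp, ← mgf_zero (X := X) (μ := P), ← hz]
      exact norm_complexMGF_le_mgf
    have h₁ := hle Complex.I Complex.I_re
    have h₂ := hle (-Complex.I) (by simp)
    simp only [ha, Complex.add_re, Complex.I_sq, neg_sq, mul_neg, mul_one, Complex.neg_re] at h₁ h₂
    linarith
  refine ⟨b.re, (2 * c.re).toNNReal, hasLaw_gaussianReal_of_mgf_eq
    hsub.aestronglyMeasurable.aemeasurable fun t => ?_⟩
  rw [hmgf, ha, Real.coe_toNNReal _ (by positivity)]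
  ring_nf

end IsInfinitelyDivisible

end InfinitelyDivisible

section GaussianComparison

variable {Ω : Type*} [MeasurableSpace Ω] {P : Measure Ω} {X Y : Ω → ℝ}

theorem le_of_forall_mul_sq_add_mul_le {a b c d : ℝ}
    (h : ∀ t, 0 ≤ t → a * t ^ 2 + b * t ≤ c * t ^ 2 + d * t) : a ≤ c := by
  by_contra! hca
  have hpos : 0 < a - c := sub_pos.2 hca
  set t := (|d - b| + 1) / (a - c)
  have ht0 : 0 < t := div_pos (by positivity) hpos
  have hat : (a - c) * t = |d - b| + 1 := mul_div_cancel₀ _ hpos.ne'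
  have hle : (|d - b| + 1) * t ≤ (d - b) * t := by
    rw [← hat]
    linarith [h t ht0.le]
  linarith [le_of_mul_le_mul_right hle ht0, le_abs_self (d - b)]

theorem gaussianReal_variance_le_of_ae_le {m₁ m₂ : ℝ} {s₁ s₂ : ℝ≥0}
    (hX : HasLaw X (gaussianReal m₁ s₁) P) (hY : HasLaw Y (gaussianReal m₂ s₂) P)
    (hle : X ≤ᵐ[P] Y) : s₁ ≤ s₂ := by
  have hmgf (t : ℝ) (ht : 0 ≤ t) : (s₁ / 2 : ℝ) * t ^ 2 + m₁ * t ≤ s₂ / 2 * t ^ 2 + m₂ * t := by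
    have hexp := mgf_mono_of_nonneg hle ht
      ((isSubgaussian_of_hasLaw_isGaussian hY).integrable_exp_mul t)
    rw [mgf_gaussianReal hX.map_eq, mgf_gaussianReal hY.map_eq, Real.exp_le_exp] at hexp
    linarith
  have hhalf := le_of_forall_mul_sq_add_mul_le hmgf
  exact NNReal.coe_le_coe.1 (by linarith)

theorem gaussianReal_variance_eq_of_ae_le {m₁ m₂ : ℝ} {s₁ s₂ : ℝ≥0}
    (hX : HasLaw X (gaussianReal m₁ s₁) P) (hY : HasLaw Y (gaussianReal m₂ s₂) P)
    (hle : X ≤ᵐ[P] Y) : s₁ = s₂ :=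
  (gaussianReal_variance_le_of_ae_le hX hY hle).antisymm <|
    gaussianReal_variance_le_of_ae_le (gaussianReal_neg hY) (gaussianReal_neg hX) <|
      hle.mono fun _ => neg_le_neg

theorem not_isInfinitelyDivisible_of_indepFun_gaussianReal_le [IsProbabilityMeasure P]
    {D₁ D₂ : Ω → ℝ} {m₁ m₂ : ℝ} {w₁ w₂ : ℝ≥0} (hX : IsSubgaussian X P)
    (hD₁ : HasLaw D₁ (gaussianReal m₁ w₁) P) (hD₂ : HasLaw D₂ (gaussianReal m₂ w₂) P)
    (hindep : IndepFun D₁ D₂ P) (hw : w₁ ≠ 0) (hle₁ : D₁ ≤ᵐ[P] X) (hle₂ : D₂ ≤ᵐ[P] X) :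
    ¬ IsInfinitelyDivisible X P := fun hdiv => by
  obtain ⟨m, s, hlaw⟩ := hdiv.exists_hasLaw_gaussianReal hX
  have hmean := gaussianReal_div_const ⟨hD₁.aemeasurable.add hD₂.aemeasurable,
    gaussianReal_add_gaussianReal_of_indepFun hindep hD₁.map_eq hD₂.map_eq⟩ 2
  have hmean_le : (fun ω => (D₁ + D₂) ω / 2) ≤ᵐ[P] X := by
    filter_upwards [hle₁, hle₂] with ω h₁ h₂
    rw [Pi.add_apply]
    linarith
  have h₁ : w₁ = s := gaussianReal_variance_eq_of_ae_le hD₁ hlaw hle₁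
  have h₂ : w₂ = s := gaussianReal_variance_eq_of_ae_le hD₂ hlaw hle₂
  have hvar := congrArg NNReal.toReal (gaussianReal_variance_eq_of_ae_le hmean hlaw hmean_le)
  rw [h₁, h₂] at hvar
  push_cast at hvar
  exact hw (by rw [h₁, ← NNReal.coe_eq_zero]; linarith)

end GaussianComparison

section LargestEigenvalue

open scoped ComplexOrder MatrixOrder

variable {n 𝕜 : Type*} [Fintype n] [DecidableEq n] [RCLike 𝕜] {A B : Matrix n n 𝕜}

theorem abs_largestEigenvalue_le_sum_norm [Nonempty n] (hA : A.IsHermitian) :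
    |largestEigenvalue A| ≤ ∑ i, ∑ j, ‖A i j‖ := by
  let _ : NormedRing (Matrix n n 𝕜) := Matrix.linftyOpNormedRing
  let _ : NormedAlgebra ℝ (Matrix n n 𝕜) := Matrix.linftyOpNormedAlgebra
  have : NormOneClass (Matrix n n 𝕜) := Matrix.linfty_opNormOneClass
  have hrows : ‖A‖₊ ≤ ∑ i, ∑ j, ‖A i j‖₊ := by
    rw [Matrix.linfty_opNNNorm_def]
    exact Finset.sup_le fun i hi => Finset.single_le_sum_of_canonicallyOrdered
      (f := fun i => ∑ j, ‖A i j‖₊) hi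
  calc |largestEigenvalue A| ≤ ‖A‖ :=
        spectrum.norm_le_norm_of_mem (largestEigenvalue_isGreatest hA).1
    _ ≤ ∑ i, ∑ j, ‖A i j‖ := by
      simpa only [← NNReal.coe_le_coe, coe_nnnorm, NNReal.coe_sum] using hrows

variable [Nonempty n]

theorem largestEigenvalue_le_iff (hA : A.IsHermitian) {r : ℝ} :
    largestEigenvalue A ≤ r ↔ A ≤ algebraMap ℝ (Matrix n n 𝕜) r := by
  rw [le_algebraMap_iff_spectrum_le (ha := hA.isSelfAdjoint)]
  exact isLUB_le_iff (largestEigenvalue_isGreatest hA).isLUB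

theorem le_algebraMap_largestEigenvalue (hA : A.IsHermitian) :
    A ≤ algebraMap ℝ (Matrix n n 𝕜) (largestEigenvalue A) :=
  (largestEigenvalue_le_iff hA).1 le_rfl

theorem re_diag_le_largestEigenvalue (hA : A.IsHermitian) (i : n) :
    RCLike.re (A i i) ≤ largestEigenvalue A := by
  have hdiag := (Matrix.le_iff.1 (le_algebraMap_largestEigenvalue hA)).diag_nonneg (i := i)
  have hre := (RCLike.nonneg_iff.1 hdiag).1
  simpa [Matrix.algebraMap_matrix_apply] using hre

theorem largestEigenvalue_add_le (hA : A.IsHermitian) (hB : B.IsHermitian) :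
    largestEigenvalue (A + B) ≤ largestEigenvalue A + largestEigenvalue B := by
  rw [largestEigenvalue_le_iff (hA.add hB), map_add]
  exact add_le_add (le_algebraMap_largestEigenvalue hA) (le_algebraMap_largestEigenvalue hB)

theorem largestEigenvalue_sub_le (hA : A.IsHermitian) (hB : B.IsHermitian) :
    largestEigenvalue A - largestEigenvalue B ≤ ∑ i, ∑ j, ‖A i j - B i j‖ := by
  have hadd := largestEigenvalue_add_le (hA.sub hB) hB
  rw [sub_add_cancel] at hadd
  have hnorm := le_of_abs_le (abs_largestEigenvalue_le_sum_norm (hA.sub hB))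
  simp only [Matrix.sub_apply] at hnorm
  linarith

theorem continuousOn_largestEigenvalue :
    ContinuousOn largestEigenvalue {A : Matrix n n 𝕜 | A.IsHermitian} := fun A hA => by
  have hlim : Filter.Tendsto (fun B : Matrix n n 𝕜 => ∑ i, ∑ j, ‖B i j - A i j‖)
      (nhdsWithin A {A | A.IsHermitian}) (nhds 0) := by
    have hcont : Continuous fun B : Matrix n n 𝕜 => ∑ i, ∑ j, ‖B i j - A i j‖ := by fun_prop
    have hlim := hcont.tendsto A
    simp only [sub_self, norm_zero, Finset.sum_const_zero] at hlim
    exact hlim.mono_left nhdsWithin_le_nhds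
  refine tendsto_iff_norm_sub_tendsto_zero.2 (squeeze_zero' (.of_forall fun _ => norm_nonneg _)
    (eventually_mem_nhdsWithin.mono fun B hB => ?_) hlim)
  refine abs_sub_le_iff.2 ⟨largestEigenvalue_sub_le hB hA, ?_⟩
  simpa only [norm_sub_rev] using largestEigenvalue_sub_le hA hB

variable {Ω : Type*} [MeasurableSpace Ω] {P : Measure Ω} {H : Ω → Matrix n n 𝕜}

theorem aemeasurable_largestEigenvalue (hH : ∀ ω, (H ω).IsHermitian)
    (hmeas : ∀ i j, AEMeasurable (fun ω => H ω i j) P) :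
    AEMeasurable (fun ω => largestEigenvalue (H ω)) P := by
  have hcont : Continuous fun A : {A : n → n → 𝕜 // (Matrix.of A).IsHermitian} =>
      largestEigenvalue (Matrix.of A.1) :=
    continuousOn_largestEigenvalue.comp_continuous continuous_subtype_val fun A => A.2
  have hHmeas : AEMeasurable (fun ω =>
      (⟨fun i j => H ω i j, hH ω⟩ : {A : n → n → 𝕜 // (Matrix.of A).IsHermitian})) P :=
    (aemeasurable_pi_lambda _ fun i => aemeasurable_pi_lambda _ (hmeas i)).subtype_mk
  exact (hcont.measurable.comp_aemeasurable hHmeas).congr (ae_of_all _ fun _ => rfl)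

theorem isSubgaussian_largestEigenvalue [IsFiniteMeasure P] (hH : ∀ ω, (H ω).IsHermitian)
    (hsub : ∀ i j, IsSubgaussian (fun ω => H ω i j) P) :
    IsSubgaussian (fun ω => largestEigenvalue (H ω)) P := by
  have hsum : IsSubgaussian (∑ i, ∑ j, fun ω => ‖H ω i j‖) P :=
    .sum _ fun i _ => .sum _ fun j _ => (hsub i j).norm
  refine hsum.mono (aemeasurable_largestEigenvalue hH fun i j =>
    (hsub i j).aestronglyMeasurable.aemeasurable).aestronglyMeasurable (ae_of_all _ fun ω => ?_)
  simp only [Finset.sum_apply]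
  exact (abs_largestEigenvalue_le_sum_norm (hH ω)).trans (Real.le_norm_self _)

end LargestEigenvalue

section Ensembles

variable {Ω : Type*} [MeasurableSpace Ω] {P : Measure Ω}

theorem isSubgaussian_apply_of_isHermitian {n 𝕜 : Type*} [LinearOrder n] [RCLike 𝕜]
    {H : Ω → Matrix n n 𝕜} (hH : ∀ ω, (H ω).IsHermitian)
    (hsub : ∀ i j, i ≤ j → IsSubgaussian (fun ω => H ω i j) P) (i j : n) :
    IsSubgaussian (fun ω => H ω i j) P := by
  rcases le_total i j with hij | hji
  · exact hsub i j hij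
  · have hstar : (fun ω => H ω i j) = fun ω => star (H ω j i) :=
      funext fun ω => ((hH ω).apply i j).symm
    rw [hstar]
    exact (hsub j i hji).mono (RCLike.continuous_conj.comp_aestronglyMeasurable
      (hsub j i hji).aestronglyMeasurable) (ae_of_all _ fun ω => (norm_star _).le)

variable {N : ℕ} {v : ℝ≥0}

namespace IsGOE

variable {H : Ω → Matrix (Fin N) (Fin N) ℝ}

theorem isHermitian (hH : IsGOE H v P) (ω : Ω) : (H ω).IsHermitian :=
  (Matrix.conjTranspose_eq_transpose_of_trivial _).trans (hH.isSymm ω)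

theorem isSubgaussian_apply (hH : IsGOE H v P) (i j : Fin N) :
    IsSubgaussian (fun ω => H ω i j) P := by
  refine isSubgaussian_apply_of_isHermitian hH.isHermitian (fun i j hij => ?_) i j
  rcases hij.eq_or_lt with rfl | hlt
  · exact isSubgaussian_of_hasLaw_isGaussian (hH.law_diag i)
  · exact isSubgaussian_of_hasLaw_isGaussian (hH.law_offDiag i j hlt)

theorem indepFun_diag (hH : IsGOE H v P) {i j : Fin N} (hij : i ≠ j) :
    IndepFun (fun ω => H ω i i) (fun ω => H ω j j) P :=
  hH.indep.indepFun (i := ⟨(i, i), le_rfl⟩) (j := ⟨(j, j), le_rfl⟩) (by simpa using hij)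

end IsGOE

namespace IsGUE

variable {H : Ω → Matrix (Fin N) (Fin N) ℂ}

theorem isSubgaussian_apply (hH : IsGUE H v P) (i j : Fin N) :
    IsSubgaussian (fun ω => H ω i j) P := by
  refine isSubgaussian_apply_of_isHermitian hH.isHermitian (fun i j hij => ?_) i j
  rcases hij.eq_or_lt with rfl | hlt
  · have hre : (fun ω => H ω i i) = fun ω => ((H ω i i).re : ℂ) :=
      funext fun ω => ((hH.isHermitian ω).coe_re_apply_self i).symm
    have hsub := isSubgaussian_of_hasLaw_isGaussian (hH.law_diag i)
    rw [hre]
    exact hsub.mono (Complex.continuous_ofReal.comp_aestronglyMeasurable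
      hsub.aestronglyMeasurable) (ae_of_all _ fun ω => (Complex.norm_real _).le)
  · exact .of_re_im (isSubgaussian_of_hasLaw_isGaussian (hH.law_offDiag_re i j hlt))
      (isSubgaussian_of_hasLaw_isGaussian (hH.law_offDiag_im i j hlt))

theorem indepFun_diag (hH : IsGUE H v P) {i j : Fin N} (hij : i ≠ j) :
    IndepFun (fun ω => (H ω i i).re) (fun ω => (H ω j j).re) P := by
  simpa using hH.indep.indepFun (i := (i, i)) (j := (j, j)) (by simpa using hij)

end IsGUE

end Ensembles

theorem theorem2_general {n 𝕜 : Type*} [Fintype n] [DecidableEq n] [RCLike 𝕜] {Ω : Type*}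
    [MeasurableSpace Ω] {P : Measure Ω} [IsProbabilityMeasure P] {H : Ω → Matrix n n 𝕜}
    (hH : ∀ ω, (H ω).IsHermitian) (hsub : ∀ i j, IsSubgaussian (fun ω => H ω i j) P)
    {i j : n} {m₁ m₂ : ℝ} {w₁ w₂ : ℝ≥0}
    (hi : HasLaw (fun ω => RCLike.re (H ω i i)) (gaussianReal m₁ w₁) P)
    (hj : HasLaw (fun ω => RCLike.re (H ω j j)) (gaussianReal m₂ w₂) P)
    (hindep : IndepFun (fun ω => RCLike.re (H ω i i)) (fun ω => RCLike.re (H ω j j)) P)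
    (hw : w₁ ≠ 0) :
    AEMeasurable (fun ω => largestEigenvalue (H ω)) P ∧
      ¬ IsInfinitelyDivisible (fun ω => largestEigenvalue (H ω)) P := by
  have : Nonempty n := ⟨i⟩
  have hmax := isSubgaussian_largestEigenvalue hH hsub
  exact ⟨hmax.aestronglyMeasurable.aemeasurable,
    not_isInfinitelyDivisible_of_indepFun_gaussianReal_le hmax hi hj hindep hw
      (ae_of_all _ fun ω => re_diag_le_largestEigenvalue (hH ω) i)
      (ae_of_all _ fun ω => re_diag_le_largestEigenvalue (hH ω) j)⟩

theorem theorem2 (N : ℕ) (hN : 2 ≤ N) (v : ℝ≥0) (hv : 0 < v)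
    {Ω : Type*} [MeasurableSpace Ω] (P : Measure Ω) [IsProbabilityMeasure P] :
    (∀ H : Ω → Matrix (Fin N) (Fin N) ℝ, IsGOE H v P →
      AEMeasurable (fun ω => largestEigenvalue (H ω)) P ∧
        ¬ IsInfinitelyDivisible (fun ω => largestEigenvalue (H ω)) P) ∧
    (∀ H : Ω → Matrix (Fin N) (Fin N) ℂ, IsGUE H v P →
      AEMeasurable (fun ω => largestEigenvalue (H ω)) P ∧
        ¬ IsInfinitelyDivisible (fun ω => largestEigenvalue (H ω)) P) := by
  have : Nontrivial (Fin N) := Fin.nontrivial_iff_two_le.2 hN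
  obtain ⟨i, j, hij⟩ := exists_pair_ne (Fin N)
  exact ⟨fun H hH => theorem2_general hH.isHermitian hH.isSubgaussian_apply (hH.law_diag i)
      (hH.law_diag j) (hH.indepFun_diag hij) (by positivity),
    fun H hH => theorem2_general hH.isHermitian hH.isSubgaussian_apply (hH.law_diag i)
      (hH.law_diag j) (hH.indepFun_diag hij) hv.ne'⟩
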